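/- Let $\varphi\colon[-1,1]\to\mathbb R$ be a non-vanishing Lebesgue measurable function and $(\alpha_k)_{k\ge 0}$ a positive sequence with $\sum_{k}\alpha_k^{-1}<\infty$. Let $H(K)$ be the reproducing kernel Hilbert space, with norm $\|\cdot\|_K$, of the kernel $$K(x,y)=\varphi(x)\varphi(y)\sum_{k=0}^\infty \alpha_k^{-1}x^ky^k,\qquad x,y\in[-1,1].$$ Assume that (A$\varphi$) $\;0<\varphi_{\min}=\inf_{x\in[-1,1]}|\varphi(x)|\le \sup_{x\in[-1,1]}|\varphi(x)|=\varphi_{\max}<\infty$, and that for some constant $\lambda>0$ (A$\alpha$) $\;\alpha_k/\alpha_n\le \lambda^{n-k}\,k!/n!$ for all $n\ge 0$ and $0\le k\le n$. Put $$m_L(\lambda)=\max\Big\{5\lambda,\ \lambda\big(1+\tfrac{\lambda}{2}\big)^2,\ \tfrac{9}{\lambda}\Big\},$$ $$c_L(\lambda)=\frac{e^{\frac12\lambda+2\sqrt\lambda}}{2\sqrt\pi\,\lambda^{1/4}}\Big(3+\sqrt{\tfrac{\pi}{e}}+\frac{2}{\sqrt\pi\,\lambda^{1/4}}+\frac{7}{16\sqrt\lambda}+\sqrt\lambda\,(2+\lambda)\Big),$$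 $$c_{1,\infty}=\sqrt{\tfrac{2}{1+\lambda}}\;e^{-\lambda^2/32}\,\varphi_{\min},\qquad c_{2,\infty}=2\sqrt{c_L(\lambda)}\;\varphi_{\max}.$$ A linear approximation based on points $x_1,\dots,x_n\in[-1,1]$ is a map of the form $A_nf=\sum_{k=1}^n f(x_k)\psi_k$ with real-valued Lebesgue measurable functions $\psi_1,\dots,\psi_n$ on $[-1,1]$, and its worst-case error is $$e_\infty(A_n)=\sup_{0\ne f\in H(K)}\ \frac{\sup_{t\in[-1,1]}|f(t)-(A_nf)(t)|}{\|f\|_K}.$$ **Theorem 3.5.** For every integer $n\ge m_L(\lambda)$ and all pairwise distinct points $x_1,\dots,x_n\in[-1,1]$ there is a linear approximation $A_n$ based on these points, namely the weighted polynomial interpolant $$(A_nf)(t)=\varphi(t)\sum_{k=1}^n\frac{f(x_k)}{\varphi(x_k)}\prod_{i\ne k}\frac{t-x_i}{x_k-x_i},$$ such that $$c_{1,\infty}\,2^{-n}\alpha_n^{-1/2}\ \le\ e_\infty(A_n)\ \le\ \frac{c_{2,\infty}}{2}\,n^{-1/8}e^{\sqrt{\lambda n}}\,2^n\alpha_n^{-1/2}.$$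 -/

import Mathlib

open Set MeasureTheory

attribute [local instance] MeasureTheory.Measure.Subtype.measureSpace

/-- The interval `[-1, 1]`, with Lebesgue measure. -/
abbrev SymmInterval : Type := Icc (-1 : ℝ) 1

/-- The data of a weighted power series kernel: a non-vanishing Lebesgue measurable function `φ`
on `[-1, 1]` and a positive sequence `α` with `∑ 1 / α k < ∞`. -/
structure WeightedPowerSeries where
  φ : SymmInterval → ℝ
  φ_ne_zero : ∀ x, φ x ≠ 0
  φ_measurable : NullMeasurable φ volume
  α : ℕ → ℝ
  α_pos : ∀ k, 0 < α k
  α_summable : Summable fun k => (α k)⁻¹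

noncomputable section

namespace WeightedPowerSeries

variable (D : WeightedPowerSeries)

/-- The kernel `K(x, y) = φ(x) φ(y) ∑ₖ αₖ⁻¹ xᵏ yᵏ`. -/
def K (x y : SymmInterval) : ℝ :=
  D.φ x * D.φ y * ∑' k : ℕ, (D.α k)⁻¹ * (x : ℝ) ^ k * (y : ℝ) ^ k

/-- The kernel as a matrix of operators on the scalars (multiplication by `K x y`), the form in
which Mathlib treats kernels of (vector-valued) reproducing kernel Hilbert spaces. -/
def kernelMatrix : Matrix SymmInterval SymmInterval (ℝ →L[ℝ] ℝ) :=
  Matrix.of fun x y => D.K x y • ContinuousLinearMap.id ℝ ℝ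

theorem summable_terms (x y : SymmInterval) :
    Summable fun k : ℕ => (D.α k)⁻¹ * (x : ℝ) ^ k * (y : ℝ) ^ k := by
  refine Summable.of_norm_bounded D.α_summable fun k => ?_
  have hx : |(x : ℝ)| ≤ 1 := abs_le.2 x.2
  have hy : |(y : ℝ)| ≤ 1 := abs_le.2 y.2
  have hk := D.α_pos k
  rw [norm_mul, norm_mul, norm_pow, norm_pow, Real.norm_eq_abs, Real.norm_eq_abs,
    Real.norm_eq_abs, abs_of_pos (inv_pos.2 hk), mul_assoc]
  refine mul_le_of_le_one_right (inv_pos.2 hk).le ?_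
  exact mul_le_one₀ (pow_le_one₀ (abs_nonneg _) hx) (by positivity)
    (pow_le_one₀ (abs_nonneg _) hy)

/-- The kernel is positive semidefinite. -/
theorem posSemidef_kernelMatrix : D.kernelMatrix.PosSemidef := by
  have htfae := (RKHS.posSemidef_tfae (𝕜 := ℝ) (K := D.kernelMatrix)).out 0 2
  refine htfae.mpr ⟨?_, fun v => ?_⟩
  · ext x y
    simp only [kernelMatrix, Matrix.conjTranspose_apply, Matrix.of_apply, star_smul,
      star_trivial]
    have : star (ContinuousLinearMap.id ℝ ℝ) = ContinuousLinearMap.id ℝ ℝ :=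
      star_one (ℝ →L[ℝ] ℝ)
    rw [this]
    have hK : D.K y x = D.K x y := by
      unfold K
      rw [mul_comm (D.φ y)]
      congr 1
      exact tsum_congr fun k => by ring
    rw [hK]
  · have key : (v.sum fun x w => v.sum fun x' w' =>
          inner ℝ (D.kernelMatrix x' x w) w')
        = ∑' k : ℕ, (D.α k)⁻¹ * (∑ x ∈ v.support, v x * D.φ x * (x : ℝ) ^ k) ^ 2 := by
      have h1 : ∀ k : ℕ, (D.α k)⁻¹ * (∑ x ∈ v.support, v x * D.φ x * (x : ℝ) ^ k) ^ 2
          = ∑ x ∈ v.support, ∑ y ∈ v.support, (v x * v y * (D.φ x * D.φ y)) *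
              ((D.α k)⁻¹ * (y : ℝ) ^ k * (x : ℝ) ^ k) := by
        intro k
        rw [sq, Finset.sum_mul_sum, Finset.mul_sum]
        refine Finset.sum_congr rfl fun x _ => ?_
        rw [Finset.mul_sum]
        refine Finset.sum_congr rfl fun y _ => ?_
        ring
      rw [tsum_congr h1, Summable.tsum_finsetSum]
      · unfold Finsupp.sum
        refine Finset.sum_congr rfl fun x _ => ?_
        rw [Summable.tsum_finsetSum]
        · refine Finset.sum_congr rfl fun y _ => ?_
          rw [tsum_mul_left]
          simp only [kernelMatrix, K, Matrix.of_apply, smul_eq_mul, FunLike.coe_smul,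
            Pi.smul_apply, ContinuousLinearMap.id_apply, RCLike.inner_apply, conj_trivial]
          ring
        · exact fun y _ => (D.summable_terms y x).mul_left _
      · exact fun x _ => summable_sum fun y _ => (D.summable_terms y x).mul_left _
    rw [key]
    exact tsum_nonneg fun k => mul_nonneg (inv_pos.2 (D.α_pos k)).le (sq_nonneg _)

instance fact_posSemidef_kernelMatrix : Fact D.kernelMatrix.PosSemidef :=
  ⟨D.posSemidef_kernelMatrix⟩

/-- `H(K)`, the reproducing kernel Hilbert space of the kernel `K`. Its elements coerce to
functions on `[-1, 1]`. -/
abbrev H : Type := RKHS.OfKernel D.kernelMatrix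

/-- `φ_min = inf |φ|`. -/
def φmin : ℝ := ⨅ x, |D.φ x|

/-- `φ_max = sup |φ|`. -/
def φmax : ℝ := ⨆ x, |D.φ x|

/-- The assumption `0 < φ_min ≤ φ_max < ∞`. -/
def AssumptionPhi : Prop := 0 < D.φmin ∧ BddAbove (range fun x => |D.φ x|)

/-- The assumption `α k / α n ≤ lam ^ (n - k) * k! / n!` for all `0 ≤ k ≤ n`, with `lam > 0`. -/
def AssumptionAlpha (lam : ℝ) : Prop :=
  0 < lam ∧ ∀ n k : ℕ, k ≤ n →
    D.α k / D.α n ≤ lam ^ (n - k) * ((k.factorial : ℝ) / (n.factorial : ℝ))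

end WeightedPowerSeries

/-- The uniform norm of a function on `[-1, 1]`, possibly infinite. -/
def supNorm (g : SymmInterval → ℝ) : ENNReal := ⨆ t, ‖g t‖ₑ

/-- A linear approximation `f ↦ ∑ₖ f(xₖ) ψₖ` based on function values at the points
`x 1, …, x n`, with Lebesgue measurable functions `ψₖ`. -/
structure LinearApproximation {n : ℕ} (x : Fin n → SymmInterval) where
  ψ : Fin n → SymmInterval → ℝ
  measurable : ∀ k, NullMeasurable (ψ k) volume

namespace LinearApproximation

variable {n : ℕ} {x : Fin n → SymmInterval}

/-- The approximation `∑ₖ f(xₖ) ψₖ` of `f`. -/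
def approx (A : LinearApproximation x) (f : SymmInterval → ℝ) (t : SymmInterval) : ℝ :=
  ∑ k, f (x k) * A.ψ k t

/-- The worst-case error `sup_{0 ≠ f ∈ H(K)} ‖f - A f‖_∞ / ‖f‖_K`, possibly infinite. -/
def worstCaseError (A : LinearApproximation x) (D : WeightedPowerSeries) : ENNReal :=
  ⨆ (f : D.H) (_ : f ≠ 0), supNorm (fun t => f t - A.approx f t) / ‖f‖ₑ

end LinearApproximation

/-- The weighted polynomial interpolant of `f` at the points `x 1, …, x n`,
`φ(t) ∑ₖ (f(xₖ) / φ(xₖ)) ∏_{i ≠ k} (t - xᵢ) / (xₖ - xᵢ)`. -/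
def weightedInterpolant (D : WeightedPowerSeries) {n : ℕ} (x : Fin n → SymmInterval)
    (f : SymmInterval → ℝ) (t : SymmInterval) : ℝ :=
  D.φ t * ∑ k, f (x k) / D.φ (x k) *
    ∏ i ∈ Finset.univ.erase k, ((t : ℝ) - x i) / ((x k : ℝ) - x i)

/-- The constant `c_L(lam)`. -/
def cL (lam : ℝ) : ℝ :=
  Real.exp (lam / 2 + 2 * √lam) / (2 * √Real.pi * lam ^ (1 / 4 : ℝ)) *
    (3 + √(Real.pi / Real.exp 1) + 2 / (√Real.pi * lam ^ (1 / 4 : ℝ)) + 7 / (16 * √lam)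
      + √lam * (2 + lam))

/-- The threshold `m_L(lam) = max {5 lam, lam (1 + lam / 2)², 9 / lam}`. -/
def mL (lam : ℝ) : ℝ := max (5 * lam) (max (lam * (1 + lam / 2) ^ 2) (9 / lam))

/-- The constant `c_{1,∞} = √(2 / (1 + lam)) exp(-lam² / 32) φ_min`. -/
def c1Inf (D : WeightedPowerSeries) (lam : ℝ) : ℝ :=
  √(2 / (1 + lam)) * Real.exp (-(lam ^ 2 / 32)) * D.φmin

/-- The constant `c_{2,∞} = 2 √(c_L(lam)) φ_max`. -/
def c2Inf (D : WeightedPowerSeries) (lam : ℝ) : ℝ := 2 * √(cL lam) * D.φmax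

end

/-! ### Worst-case errors as norms of representers -/

namespace WeightedPowerSeries

/-! The worst-case error is the supremum over `t` of the norm of the functional `f ↦ f t - A f t`.
Expanding the kernel, the weighted interpolant has squared norm `φ(t)² ∑ₘ αₘ⁻¹ Eₘ(t)²`, where `Eₘ`
is the error of interpolating the monomial `tᵐ` (`hasSum_norm_sq_representer_weightedLagrange`).

Upper bound: `Eₘ = 0` for `m < n`. Otherwise `Eₘ` is the nodal polynomial times a complete
homogeneous symmetric polynomial, so `|Eₘ| ≤ 2ⁿ C(m, n)`. The growth condition on `α` turns the
series into `4ⁿ αₙ⁻¹ ∑ⱼ C(n+j, j) λʲ / j! = 4ⁿ αₙ⁻¹ exp(λ) Lₙ(-λ)`, and comparison with the Bessel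
function `I₀` bounds this Laguerre value (`laguerre_bound_le_cL`).

Lower bound: the nodal polynomial `w = ∑ wₖ tᵏ` equals `∑ wₖ Eₖ`, so Cauchy–Schwarz gives `w(t)² ≤
(∑ αₖ wₖ²)(∑ αₖ⁻¹ Eₖ(t)²)`. A polynomial with large coefficients is large somewhere:
`exists_sum_coeff_sq_le` supplies `t` with `∑ αₖ wₖ² ≤ M w(t)²`, by Chebyshev expansion. Hence the
error series at that `t` is at least `1 / M`. -/

theorem inner_kerFun_kerFun (D : WeightedPowerSeries) (x y : SymmInterval) :
    inner ℝ (RKHS.kerFun D.H x (1 : ℝ)) (RKHS.kerFun D.H y (1 : ℝ)) = D.K x y := by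
  rw [real_inner_comm, ← RKHS.kernel_inner, RKHS.OfKernel.kernel_ofKernel]
  simp [kernelMatrix]

/-- The norm of a linear combination of kernel functions. -/
theorem hasSum_norm_sq_sum_kerFun (D : WeightedPowerSeries) {ι : Type*} [Fintype ι]
    (y : ι → SymmInterval) (w : ι → ℝ) :
    HasSum (fun m : ℕ => (D.α m)⁻¹ * (∑ i, w i * D.φ (y i) * (y i : ℝ) ^ m) ^ 2)
      (‖∑ i, w i • RKHS.kerFun D.H (y i) (1 : ℝ)‖ ^ 2) := by
  rw [← real_inner_self_eq_norm_sq, sum_inner]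
  simp_rw [inner_sum, real_inner_smul_left, real_inner_smul_right, inner_kerFun_kerFun]
  have h : ∀ i j, HasSum (fun m : ℕ => w i * (w j * (D.φ (y i) * D.φ (y j))) *
      ((D.α m)⁻¹ * (y i : ℝ) ^ m * (y j : ℝ) ^ m)) (w i * (w j * D.K (y i) (y j))) := by
    intro i j
    have hk : w i * (w j * D.K (y i) (y j)) = w i * (w j * (D.φ (y i) * D.φ (y j))) *
        ∑' k : ℕ, (D.α k)⁻¹ * (y i : ℝ) ^ k * (y j : ℝ) ^ k := by rw [K]; ring
    rw [hk]
    exact (D.summable_terms (y i) (y j)).hasSum.mul_left _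
  convert hasSum_sum fun i _ => hasSum_sum fun j _ => h i j using 2 with m
  rw [sq, Finset.sum_mul_sum, Finset.mul_sum]
  refine Finset.sum_congr rfl fun i _ => ?_
  rw [Finset.mul_sum]
  refine Finset.sum_congr rfl fun j _ => ?_
  ring

end WeightedPowerSeries

namespace LinearApproximation

variable {n : ℕ} {x : Fin n → SymmInterval}

/-- The representer of the error functional `f ↦ f t - A f t`. -/
noncomputable def representer (A : LinearApproximation x) (D : WeightedPowerSeries)
    (t : SymmInterval) : D.H :=
  -- `none` stands for the evaluation at `t`, `some k` for the node `x k`; a single indexed sum lets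
  -- the norm formula for kernel combinations apply directly.
  ∑ i : Option (Fin n), (i.elim 1 fun k => -A.ψ k t) •
    RKHS.kerFun D.H (i.elim t x) (1 : ℝ)

theorem inner_representer (A : LinearApproximation x) (D : WeightedPowerSeries)
    (t : SymmInterval) (f : D.H) :
    inner ℝ (A.representer D t) f = f t - A.approx f t := by
  simp [representer, approx, sum_inner, real_inner_smul_left, Fintype.sum_option, inner_add_left,
    mul_comm, sub_eq_add_neg]

theorem hasSum_norm_sq_representer (A : LinearApproximation x) (D : WeightedPowerSeries)
    (t : SymmInterval) :
    HasSum (fun m : ℕ => (D.α m)⁻¹ *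
      (D.φ t * (t : ℝ) ^ m - ∑ k, A.ψ k t * D.φ (x k) * (x k : ℝ) ^ m) ^ 2)
      (‖A.representer D t‖ ^ 2) := by
  convert D.hasSum_norm_sq_sum_kerFun (ι := Option (Fin n)) (fun i => i.elim t x)
    (fun i => i.elim 1 fun k => -A.ψ k t) using 4 with m
  · simp [Fintype.sum_option, sub_eq_add_neg]
  · rfl

theorem worstCaseError_le (A : LinearApproximation x) (D : WeightedPowerSeries) {C : ℝ}
    (h : ∀ t, ‖A.representer D t‖ ≤ C) : A.worstCaseError D ≤ ENNReal.ofReal C := by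
  refine iSup₂_le fun f hf => ENNReal.div_le_of_le_mul <| iSup_le fun t => ?_
  beta_reduce
  rw [← A.inner_representer D t f, ← ofReal_norm, ← ofReal_norm, ← ENNReal.ofReal_mul' (norm_nonneg _)]
  exact ENNReal.ofReal_le_ofReal ((norm_inner_le_norm _ _).trans
    (mul_le_mul_of_nonneg_right (h t) (norm_nonneg _)))

/-- The representer itself is the extremal test function. -/
theorem le_worstCaseError (A : LinearApproximation x) (D : WeightedPowerSeries)
    (t : SymmInterval) : ENNReal.ofReal ‖A.representer D t‖ ≤ A.worstCaseError D := by
  by_cases h0 : A.representer D t = 0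
  · simp [h0]
  refine le_trans ?_ (le_iSup₂ (f := fun (f : D.H) (_ : f ≠ 0) =>
    supNorm (fun t => f t - A.approx f t) / ‖f‖ₑ) (A.representer D t) h0)
  rw [ENNReal.le_div_iff_mul_le (Or.inl (by simpa using h0)) (Or.inl (by simp))]
  refine le_trans (le_of_eq ?_) (le_iSup (fun s => ‖(A.representer D t) s -
    A.approx (A.representer D t) s‖ₑ) t)
  rw [← A.inner_representer D t, real_inner_self_eq_norm_sq, ← ofReal_norm, ← ofReal_norm,
    ← ENNReal.ofReal_mul (norm_nonneg _), Real.norm_of_nonneg (sq_nonneg _), sq]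

end LinearApproximation

section Interpolation

/-! ### Interpolation errors of monomials -/

open Polynomial Finset

/-- Division of a monomial by a nodal polynomial with nodes in `[-1, 1]`, with a bound on the
quotient (a complete homogeneous symmetric polynomial in the nodes and the variable). -/
theorem exists_X_pow_eq_nodal_mul_add {ι : Type*} [DecidableEq ι] {v : ι → ℝ}
    (hv : ∀ i, |v i| ≤ 1) (s : Finset ι) (k : ℕ) :
    ∃ q r : ℝ[X], X ^ k = Lagrange.nodal s v * q + r ∧ r.degree < #s ∧
      ∀ t : ℝ, |t| ≤ 1 → |q.eval t| ≤ k.choose #s := by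
  induction s using Finset.induction_on generalizing k with
  | empty =>
    refine ⟨X ^ k, 0, by simp, by simp, fun t ht => ?_⟩
    simpa [abs_pow] using pow_le_one₀ (abs_nonneg t) ht
  | insert a s ha ih =>
    choose q r hqr hr hq using ih
    -- With `a` the new node, `Xᵏ - aᵏ = (X - a) ∑ⱼ aᵏ⁻¹⁻ʲ Xʲ`; each `Xʲ` is then divided by the old
    -- nodal polynomial. The bounds on the quotients add up by the hockey-stick identity.
    refine ⟨∑ j ∈ range k, C (v a ^ (k - 1 - j)) * q j,
      (X - C (v a)) * (∑ j ∈ range k, C (v a ^ (k - 1 - j)) * r j) + C (v a ^ k), ?_, ?_, ?_⟩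
    · have h := geom_sum₂_mul (X : ℝ[X]) (C (v a)) k
      rw [eq_sub_iff_add_eq] at h
      rw [← h, Lagrange.nodal_insert_eq_nodal ha, mul_sum, mul_sum, ← add_assoc, sum_mul,
        ← sum_add_distrib, C_pow]
      congr 1
      refine sum_congr rfl fun j _ => ?_
      rw [hqr j, C_pow]
      ring
    · rw [card_insert_of_notMem ha]
      refine (degree_add_le _ _).trans_lt (max_lt ?_ ?_)
      · rw [degree_mul, degree_X_sub_C]
        have : (∑ j ∈ range k, C (v a ^ (k - 1 - j)) * r j).degree < (#s : WithBot ℕ) := by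
          refine (degree_sum_le _ _).trans_lt ((Finset.sup_lt_iff (by simp)).2 fun j _ => ?_)
          refine (degree_mul_le _ _).trans_lt (lt_of_le_of_lt ?_ (hr j))
          exact (add_le_add_left degree_C_le _).trans (by simp)
        rw [add_comm, Nat.cast_succ]
        exact WithBot.add_lt_add_right (by simp) this
      · exact degree_C_le.trans_lt (by exact_mod_cast Nat.succ_pos _)
    · intro t ht
      rw [eval_finsetSum, card_insert_of_notMem ha]
      calc |∑ j ∈ range k, (C (v a ^ (k - 1 - j)) * q j).eval t|
          ≤ ∑ j ∈ range k, |(C (v a ^ (k - 1 - j)) * q j).eval t| := abs_sum_le_sum_abs _ _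
        _ ≤ ∑ j ∈ range k, (j.choose #s : ℝ) := by
          refine sum_le_sum fun j _ => ?_
          rw [eval_mul, eval_C, abs_mul, abs_pow]
          exact (mul_le_of_le_one_left (abs_nonneg _)
            (pow_le_one₀ (abs_nonneg _) (hv a))).trans (hq j t ht)
        _ = (k.choose (#s + 1) : ℝ) := by
          have h : ∀ k : ℕ, ∑ j ∈ range k, j.choose #s = k.choose (#s + 1) := fun k => by
            induction k with
            | zero => simp
            | succ k ihk => rw [sum_range_succ, ihk, Nat.choose_succ_succ, add_comm]
          exact_mod_cast h k

variable {n : ℕ} {v : Fin n → ℝ}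

theorem Lagrange.eval_basis_univ (v : Fin n → ℝ) (k : Fin n) (t : ℝ) :
    (Lagrange.basis univ v k).eval t = ∏ i ∈ univ.erase k, (t - v i) / (v k - v i) := by
  simp [Lagrange.basis, Lagrange.basisDivisor, eval_prod, div_eq_inv_mul]

/-- The error at `t` of interpolating a polynomial of low degree vanishes. -/
theorem sum_eval_mul_basis (hv : Function.Injective v) {r : ℝ[X]} (hr : r.degree < n) (t : ℝ) :
    ∑ k, r.eval (v k) * (Lagrange.basis univ v k).eval t = r.eval t := by
  conv_rhs => rw [Lagrange.eq_interpolate (f := r) (s := univ) (v := v) hv.injOn (by simpa using hr)]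
  simp [Lagrange.interpolate_apply, eval_finsetSum]

theorem pow_sub_interpolant_eq_zero (hv : Function.Injective v) {k : ℕ} (hk : k < n) (t : ℝ) :
    t ^ k - ∑ j, v j ^ k * (Lagrange.basis univ v j).eval t = 0 := by
  have := sum_eval_mul_basis hv (r := X ^ k) (by simpa using hk) t
  simp only [eval_pow, eval_X] at this
  rw [this, sub_self]

/-- Interpolation reproduces the remainder modulo the nodal polynomial, so the error is nodal
polynomial times quotient; each nodal factor `|t - v i|` is at most `2`. -/
theorem abs_pow_sub_interpolant_le (hv : Function.Injective v) (hv1 : ∀ i, |v i| ≤ 1) (k : ℕ)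
    {t : ℝ} (ht : |t| ≤ 1) :
    |t ^ k - ∑ j, v j ^ k * (Lagrange.basis univ v j).eval t| ≤ 2 ^ n * k.choose n := by
  obtain ⟨q, r, hqr, hr, hq⟩ := exists_X_pow_eq_nodal_mul_add hv1 univ k
  rw [card_univ, Fintype.card_fin] at hr
  have hnode : ∀ j, v j ^ k = r.eval (v j) := fun j => by
    have := congrArg (eval (v j)) hqr
    simpa [Lagrange.eval_nodal_at_node (mem_univ j)] using this
  have ht' := congrArg (eval t) hqr
  simp only [eval_pow, eval_X, eval_add, eval_mul] at ht'
  simp_rw [hnode, sum_eval_mul_basis hv hr, ht', add_sub_cancel_right, abs_mul]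
  refine mul_le_mul ?_ (by simpa using hq t ht) (abs_nonneg _) (by positivity)
  rw [Lagrange.eval_nodal, abs_prod]
  calc ∏ i, |t - v i| ≤ ∏ _i : Fin n, (2 : ℝ) := prod_le_prod (fun _ _ => abs_nonneg _) fun i _ =>
        (abs_sub _ _).trans (by linarith [hv1 i])
    _ = 2 ^ n := by simp

/-- The nodal polynomial is the combination of the interpolation errors of the monomials with
its own coefficients. -/
theorem eval_nodal_eq_sum_coeff_mul (v : Fin n → ℝ) (t : ℝ) :
    (Lagrange.nodal univ v).eval t = ∑ k ∈ range (n + 1), (Lagrange.nodal univ v).coeff k *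
      (t ^ k - ∑ j, v j ^ k * (Lagrange.basis univ v j).eval t) := by
  have hdeg : (Lagrange.nodal univ v).natDegree < n + 1 := by simp [Lagrange.natDegree_nodal]
  simp_rw [mul_sub, mul_sum, sum_sub_distrib]
  rw [← eval_eq_sum_range' hdeg, sum_comm]
  -- The interpolation part collects into values of the nodal polynomial at its own nodes.
  simp_rw [← mul_assoc, ← sum_mul, ← eval_eq_sum_range' hdeg,
    Lagrange.eval_nodal_at_node (mem_univ _)]
  simp

end Interpolation

/-! ### Bessel-type bounds for Laguerre polynomials at negative arguments -/

section BesselLaguerre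

open Finset Real
open scoped Nat

theorem sum_range_two_mul_eq {M : Type*} [AddCommMonoid M] (f : ℕ → M) (N : ℕ) :
    ∑ k ∈ range (2 * N), f k = ∑ i ∈ range N, (f (2 * i) + f (2 * i + 1)) := by
  induction N with
  | zero => simp
  | succ N ih => rw [mul_add, mul_one, sum_range_succ, sum_range_succ, ih, sum_range_succ, add_assoc]

/-- The inductive step reduces to `(2j + 1)(2j + 3) ≤ 4 (j + 1)²`. -/
theorem centralBinom_sq_mul_le (j : ℕ) : j.centralBinom ^ 2 * (2 * j + 1) ≤ 16 ^ j := by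
  induction j with
  | zero => simp
  | succ j ih =>
    have h := Nat.succ_mul_centralBinom_succ j
    refine le_of_mul_le_mul_left ?_ (pow_pos j.succ_pos 2)
    calc (j + 1) ^ 2 * ((j + 1).centralBinom ^ 2 * (2 * (j + 1) + 1))
        = ((j + 1) * (j + 1).centralBinom) ^ 2 * (2 * j + 3) := by ring
      _ = (j.centralBinom ^ 2 * (2 * j + 1)) * (4 * ((2 * j + 1) * (2 * j + 3))) := by
        rw [h]; ring
      _ ≤ 16 ^ j * (4 * ((2 * j + 1) * (2 * j + 3))) := Nat.mul_le_mul_right _ ih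
      _ ≤ 16 ^ j * (16 * (j + 1) ^ 2) := Nat.mul_le_mul_left _ (by nlinarith)
      _ = (j + 1) ^ 2 * 16 ^ (j + 1) := by ring

/-- An upper bound for the modified Bessel function `I₀(2y) = ∑ᵢ y²ⁱ / i!²`. -/
theorem sum_pow_div_factorial_sq_le {y : ℝ} (hy : 0 < y) (N : ℕ) :
    ∑ i ∈ range N, y ^ (2 * i) / (i ! : ℝ) ^ 2 ≤ exp (2 * y) / (2 * √(2 * y)) := by
  have hx : 0 < √(2 * y) := sqrt_pos.2 (by positivity)
  have hxx : √(2 * y) ^ 2 = 2 * y := sq_sqrt (by positivity)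
  -- Each Bessel term is compared with two consecutive terms of the series of `exp (2y)`.
  calc ∑ i ∈ range N, y ^ (2 * i) / (i ! : ℝ) ^ 2
      ≤ ∑ i ∈ range N, ((2 * y) ^ (2 * i) / ((2 * i)! : ℝ) +
          (2 * y) ^ (2 * i + 1) / ((2 * i + 1)! : ℝ)) / (2 * √(2 * y)) := by
        refine sum_le_sum fun i _ => ?_
        have hfac : ((2 * i)! : ℝ) = i.centralBinom * (i ! : ℝ) ^ 2 := by
          have := Nat.choose_mul_factorial_mul_factorial (show i ≤ 2 * i by omega)
          rw [show 2 * i - i = i by omega] at this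
          rw [Nat.centralBinom, ← this]
          push_cast
          ring
        have hcb : (0 : ℝ) < i.centralBinom := by exact_mod_cast i.centralBinom_pos
        have hsq : (i.centralBinom : ℝ) ^ 2 * (2 * i + 1) ≤ (4 ^ i) ^ 2 := by
          rw [← pow_mul, mul_comm i, pow_mul]
          norm_num
          exact_mod_cast centralBinom_sq_mul_le i
        have hi : (0 : ℝ) < 2 * i + 1 := by positivity
        -- `2 √(2y) · C(2i, i) ≤ 4 ^ i (1 + 2y / (2i + 1))`
        have key : 2 * √(2 * y) * i.centralBinom ≤ 4 ^ i * (1 + 2 * y / (2 * i + 1)) := by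
          have h1 : (i.centralBinom : ℝ) * √(2 * i + 1) ≤ 4 ^ i := by
            refine abs_le_of_sq_le_sq' ?_ (by positivity) |>.2
            rwa [mul_pow, sq_sqrt hi.le]
          -- AM-GM: `√a + b / √a ≥ 2 √b` with `a = 2i + 1`, `b = 2y`.
          have h2 : 2 * √(2 * y) ≤ √(2 * i + 1) * (1 + 2 * y / (2 * i + 1)) := by
            have hs : 0 < √(2 * (i : ℝ) + 1) := sqrt_pos.2 hi
            have hss : √(2 * (i : ℝ) + 1) ^ 2 = 2 * i + 1 := sq_sqrt hi.le
            rw [← hss, ← hxx, ← sub_nonneg]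
            have : √(√(2 * (i : ℝ) + 1) ^ 2) = √(2 * (i : ℝ) + 1) := sqrt_sq hs.le
            have h3 : √(√(2 * y) ^ 2) = √(2 * y) := sqrt_sq hx.le
            rw [this, h3]
            have : √(2 * (i : ℝ) + 1) * (1 + √(2 * y) ^ 2 / √(2 * (i : ℝ) + 1) ^ 2) - 2 * √(2 * y)
                = (√(2 * (i : ℝ) + 1) - √(2 * y)) ^ 2 / √(2 * (i : ℝ) + 1) := by
              field_simp
              ring
            rw [this]
            positivity
          calc 2 * √(2 * y) * i.centralBinom
              ≤ √(2 * i + 1) * (1 + 2 * y / (2 * i + 1)) * i.centralBinom := by gcongr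
            _ = i.centralBinom * √(2 * i + 1) * (1 + 2 * y / (2 * i + 1)) := by ring
            _ ≤ _ := by gcongr
        have h4 : (2 * y) ^ (2 * i) = 4 ^ i * y ^ (2 * i) := by
          rw [mul_pow, pow_mul 2]
          norm_num
        have hrhs : ((2 * y) ^ (2 * i) / ((2 * i)! : ℝ) +
            (2 * y) ^ (2 * i + 1) / ((2 * i + 1)! : ℝ)) / (2 * √(2 * y)) =
            (4 ^ i * (1 + 2 * y / (2 * i + 1))) * (y ^ (2 * i) /
              (i.centralBinom * (i ! : ℝ) ^ 2 * (2 * √(2 * y)))) := by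
          rw [Nat.factorial_succ, Nat.cast_mul, hfac, pow_succ (2 * y) (2 * i), h4]
          push_cast
          field_simp
        rw [hrhs]
        calc y ^ (2 * i) / (i ! : ℝ) ^ 2 = (2 * √(2 * y) * i.centralBinom) * (y ^ (2 * i) /
              (i.centralBinom * (i ! : ℝ) ^ 2 * (2 * √(2 * y)))) := by field_simp
          _ ≤ _ := by gcongr
    _ = (∑ k ∈ range (2 * N), (2 * y) ^ k / (k ! : ℝ)) / (2 * √(2 * y)) := by
        rw [sum_range_two_mul_eq, sum_div]
    _ ≤ exp (2 * y) / (2 * √(2 * y)) := by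
        gcongr
        exact sum_le_exp_of_nonneg (by positivity) _

/-- The falling factorial is a product of factors `n - j ≤ n exp(-j / n)`. -/
theorem choose_le_pow_div_factorial_mul_exp {n : ℕ} (hn : 0 < n) (i : ℕ) :
    (n.choose i : ℝ) ≤ (n : ℝ) ^ i / (i ! : ℝ) * exp (-(i * (i - 1) / (2 * n))) := by
  have hn' : (0 : ℝ) < n := by exact_mod_cast hn
  have h : ∀ i : ℕ, (n.descFactorial i : ℝ) ≤ (n : ℝ) ^ i * exp (-(i * (i - 1) / (2 * n))) := by
    intro i
    induction i with
    | zero => simp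
    | succ i ih =>
      have h1 : ((n - i : ℕ) : ℝ) ≤ n * exp (-(i / n)) := by
        rcases le_total i n with hi | hi
        · rw [Nat.cast_sub hi]
          have := add_one_le_exp (-((i : ℝ) / n))
          calc (n : ℝ) - i = n * (-((i : ℝ) / n) + 1) := by field_simp; ring
            _ ≤ _ := by gcongr
        · rw [Nat.sub_eq_zero_of_le hi, Nat.cast_zero]
          positivity
      rw [Nat.descFactorial_succ, Nat.cast_mul]
      calc ((n - i : ℕ) : ℝ) * n.descFactorial i
          ≤ n * exp (-(i / n)) * ((n : ℝ) ^ i * exp (-(i * (i - 1) / (2 * n)))) := by gcongr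
        _ = (n : ℝ) ^ (i + 1) * (exp (-(i / n)) * exp (-(i * (i - 1) / (2 * n)))) := by ring
        _ = _ := by
          rw [← exp_add]
          congr 2
          push_cast
          field_simp
          ring
  rw [Nat.choose_eq_descFactorial_div_factorial,
    Nat.cast_div (Nat.factorial_dvd_descFactorial n i) (by positivity), div_mul_eq_mul_div]
  gcongr
  exact h i

/-- Because `(1 + u + u²/2)(1 - u + u²/2) = 1 + u⁴/4 ≥ 1`. -/
theorem exp_neg_le_quadratic {u : ℝ} (hu : 0 ≤ u) : exp (-u) ≤ 1 - u + u ^ 2 / 2 := by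
  rw [exp_neg]
  have h := quadratic_le_exp_of_nonneg hu
  refine (inv_anti₀ (by positivity) h).trans ?_
  rw [inv_le_iff_one_le_mul₀ (by positivity)]
  nlinarith [sq_nonneg (u ^ 2)]

/-- An upper bound for the Laguerre polynomial `Lₙ(-lam) = ∑ᵢ C(n, i) lamⁱ / i!`. -/
theorem sum_choose_mul_pow_div_factorial_le {lam : ℝ} (hlam : 0 < lam) {n : ℕ}
    (h9 : 9 ≤ lam * n) (hn : lam * (1 + lam / 2) ^ 2 ≤ n) :
    ∑ i ∈ range (n + 1), (n.choose i : ℝ) * lam ^ i / (i ! : ℝ) ≤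
      exp (-(lam / 2) + 2 * √(lam * n) + 3 / 4) / (2 * √(2 * √(lam * n))) := by
  have hn0 : (0 : ℝ) < n := by
    by_contra! h
    nlinarith
  set s := √(lam * n) with hs_def
  have hs : s ^ 2 = lam * n := sq_sqrt (by positivity)
  have hs3 : 3 ≤ s := le_sqrt_of_sq_le (by norm_num; exact h9)
  have hs0 : 0 < s := by linarith
  -- `2u` is the slope of `i (i - 1) / (2n)` at `i = s`. Replacing this convex exponent by its
  -- tangent there costs `exp(lam / 2)` and leaves a Bessel sum at `y = s exp(-u)`.
  set u := s / (2 * n) - 1 / (4 * n) with hu_def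
  have hρ : s / n * (1 + lam / 2) ≤ 1 := by
    rw [div_mul_eq_mul_div, div_le_one hn0]
    refine abs_le_of_sq_le_sq' ?_ hn0.le |>.2
    rw [mul_pow, hs]
    nlinarith
  have hρ0 : 0 < s / n := by positivity
  have hu0 : 0 ≤ u := by
    have : u = (2 * s - 1) / (4 * n) := by rw [hu_def]; field_simp; ring
    rw [this]
    exact div_nonneg (by linarith) (by positivity)
  have hu1 : u ≤ s / n / 2 := by
    have h1 : 0 < 1 / (4 * (n : ℝ)) := by positivity
    have h2 : s / (2 * n) = s / n / 2 := by field_simp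
    linarith
  have hu2 : u ≤ 1 / 2 := by nlinarith
  set y := s * exp (-u) with hy_def
  have hy : 0 < y := by positivity
  have hterm : ∀ i : ℕ, (n.choose i : ℝ) * lam ^ i / (i ! : ℝ) ≤
      exp (lam / 2) * (y ^ (2 * i) / (i ! : ℝ) ^ 2) := by
    intro i
    have h1 := choose_le_pow_div_factorial_mul_exp (n := n) (by exact_mod_cast hn0) i
    have h2 : exp (-(i * (i - 1) / (2 * n))) ≤ exp (lam / 2) * exp (-u) ^ (2 * i) := by
      rw [← exp_nat_mul, ← exp_add, exp_le_exp]
      have : lam / 2 + ((2 * i : ℕ) : ℝ) * -u - -(i * (i - 1) / (2 * n)) =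
          (i - s) ^ 2 / (2 * n) := by
        rw [hu_def]
        have : lam = s ^ 2 / n := by rw [hs]; field_simp
        rw [this]
        push_cast
        field_simp
        ring
      have h3 : 0 ≤ ((i : ℝ) - s) ^ 2 / (2 * n) := by positivity
      linarith
    have h4 : y ^ (2 * i) = lam ^ i * n ^ i * exp (-u) ^ (2 * i) := by
      rw [hy_def, mul_pow, pow_mul s, hs, mul_pow]
    calc (n.choose i : ℝ) * lam ^ i / (i ! : ℝ)
        ≤ ((n : ℝ) ^ i / (i ! : ℝ) * (exp (lam / 2) * exp (-u) ^ (2 * i))) * lam ^ i / (i ! : ℝ) := by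
          gcongr
          exact h1.trans (by gcongr)
      _ = _ := by
          rw [h4]
          field_simp
  -- Second-order expansion of `exp(-u)` leaves the excess `(s / n)(1 + lam / 2) / 2`, at most `1/2`
  -- by `hρ`.
  have h2y : 2 * y ≤ 2 * s - lam + 1 / 2 := by
    have h1 := exp_neg_le_quadratic hu0
    have h2 : s * u = lam / 2 - s / n / 4 := by
      rw [hu_def]
      have : lam = s ^ 2 / n := by rw [hs]; field_simp
      rw [this]
      field_simp
    have h3 : s * u ^ 2 ≤ lam * (s / n) / 4 := by
      have : s * (s / n / 2) = lam / 2 := by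
        rw [show s * (s / n / 2) = s ^ 2 / n / 2 by ring, hs]
        field_simp
      calc s * u ^ 2 ≤ s * (s / n / 2) ^ 2 := by gcongr
        _ = (s * (s / n / 2)) * (s / n / 2) := by ring
        _ = _ := by rw [this]; ring
    have h4 : y ≤ s * (1 - u + u ^ 2 / 2) := by rw [hy_def]; gcongr
    nlinarith
  have hsq : √(2 * y) = √(2 * s) * exp (-(u / 2)) := by
    rw [hy_def, ← mul_assoc, sqrt_mul (by positivity), ← exp_half]
    congr 2
    ring
  have h2s : 0 < √(2 * s) := sqrt_pos.2 (by positivity)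
  calc ∑ i ∈ range (n + 1), (n.choose i : ℝ) * lam ^ i / (i ! : ℝ)
      ≤ ∑ i ∈ range (n + 1), exp (lam / 2) * (y ^ (2 * i) / (i ! : ℝ) ^ 2) :=
        sum_le_sum fun i _ => hterm i
    _ ≤ exp (lam / 2) * (exp (2 * y) / (2 * √(2 * y))) := by
        rw [← mul_sum]
        gcongr
        exact sum_pow_div_factorial_sq_le hy _
    _ = exp (lam / 2 + 2 * y + u / 2) / (2 * √(2 * s)) := by
        rw [hsq, exp_neg, exp_add, exp_add]
        field_simp
    _ ≤ _ := by
        -- The `3/4` is `1/2` from `h2y` plus `u / 2 ≤ 1/4`.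
        exact div_le_div_of_nonneg_right (exp_le_exp.2 (by linarith)) (by positivity)

/-- The series expansion `∑ⱼ C(n + j, j) lamʲ / j! = exp(lam) Lₙ(-lam)`. -/
theorem hasSum_choose_mul_pow_div_factorial (lam : ℝ) (n : ℕ) :
    HasSum (fun j : ℕ => ((n + j).choose j : ℝ) * lam ^ j / (j ! : ℝ))
      ((∑ i ∈ range (n + 1), (n.choose i : ℝ) * lam ^ i / (i ! : ℝ)) * exp lam) := by
  have hf : HasSum (fun i : ℕ => (n.choose i : ℝ) * lam ^ i / (i ! : ℝ))
      (∑ i ∈ range (n + 1), (n.choose i : ℝ) * lam ^ i / (i ! : ℝ)) :=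
    hasSum_sum_of_ne_finset_zero fun i hi => by
      rw [Nat.choose_eq_zero_of_lt (by simpa [Nat.lt_succ_iff] using hi)]
      simp
  have hg : HasSum (fun m : ℕ => lam ^ m / (m ! : ℝ)) (exp lam) := by
    rw [exp_eq_exp_ℝ]
    exact NormedSpace.expSeries_div_hasSum_exp lam
  -- Cauchy product of the Laguerre sum with `exp lam`, evaluated by Vandermonde's identity.
  have hterm : ∀ j : ℕ, ∑ kl ∈ antidiagonal j, (n.choose kl.1 : ℝ) * lam ^ kl.1 / (kl.1 ! : ℝ) *
      (lam ^ kl.2 / (kl.2 ! : ℝ)) = ((n + j).choose j : ℝ) * lam ^ j / (j ! : ℝ) := by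
    intro j
    rw [Nat.add_choose_eq, Nat.cast_sum, sum_mul, sum_div]
    refine sum_congr rfl fun kl hkl => ?_
    have h : kl.1 + kl.2 = j := mem_antidiagonal.1 hkl
    have hc : (j.choose kl.2 : ℝ) * ((kl.1 ! : ℝ) * (kl.2 ! : ℝ)) = (j ! : ℝ) := by
      rw [← h, ← Nat.add_choose_mul_factorial_mul_factorial kl.1 kl.2]
      push_cast
      ring
    rw [Nat.cast_mul, ← hc, ← h, pow_add]
    have : (0 : ℝ) < j.choose kl.2 := by
      exact_mod_cast Nat.choose_pos (by omega)
    rw [h]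
    field_simp
  have hs := summable_norm_sum_mul_antidiagonal_of_summable_norm hf.summable.norm hg.summable.norm
  have ht := tsum_mul_tsum_eq_tsum_sum_antidiagonal_of_summable_norm hf.summable.norm
    hg.summable.norm
  rw [hf.tsum_eq, hg.tsum_eq] at ht
  rw [ht]
  simp_rw [hterm] at hs ⊢
  exact hs.of_norm.hasSum

/-- Of the bracket in `cL` the summand `3` already suffices, since `exp(3/2) π ≤ 18`; the factor
`exp(2√lam)` is only bounded below by `1`. -/
theorem laguerre_bound_le_cL {lam : ℝ} (hlam : 0 < lam) {n : ℕ} (hn : mL lam ≤ n) :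
    (∑ i ∈ range (n + 1), (n.choose i : ℝ) * lam ^ i / (i ! : ℝ)) * exp lam ≤
      cL lam * (n : ℝ) ^ (-(1 / 4) : ℝ) * exp (2 * √(lam * n)) := by
  have h1 : lam * (1 + lam / 2) ^ 2 ≤ n := (le_max_left _ _).trans ((le_max_right _ _).trans hn)
  have h2 : 9 / lam ≤ n := (le_max_right _ _).trans ((le_max_right _ _).trans hn)
  have h9 : 9 ≤ lam * n := by rwa [div_le_iff₀' hlam] at h2
  have hn0 : (0 : ℝ) < n := lt_of_lt_of_le (by positivity) h2
  have hlag := sum_choose_mul_pow_div_factorial_le hlam h9 h1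
  have hq : 0 < lam ^ (1 / 4 : ℝ) := by positivity
  have hqn : 0 < (n : ℝ) ^ (1 / 4 : ℝ) := by positivity
  have hss : √(2 * √(lam * n)) = √2 * (lam ^ (1 / 4 : ℝ) * (n : ℝ) ^ (1 / 4 : ℝ)) := by
    rw [sqrt_mul (by norm_num), ← mul_rpow hlam.le hn0.le, sqrt_eq_rpow (√_), sqrt_eq_rpow (lam * n),
      ← rpow_mul (by positivity)]
    norm_num
  have hc : exp (lam / 2) * 3 / (2 * √π * lam ^ (1 / 4 : ℝ)) ≤ cL lam := by
    have h3 : exp (lam / 2) ≤ exp (lam / 2 + 2 * √lam) := exp_le_exp.2 (by linarith [sqrt_nonneg lam])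
    have h4 : 3 ≤ 3 + √(π / exp 1) + 2 / (√π * lam ^ (1 / 4 : ℝ)) + 7 / (16 * √lam)
      + √lam * (2 + lam) := by
      have : 0 ≤ √(π / exp 1) + 2 / (√π * lam ^ (1 / 4 : ℝ)) + 7 / (16 * √lam)
        + √lam * (2 + lam) := by positivity
      linarith
    rw [cL, mul_div_right_comm]
    gcongr
  have hnum : exp (3 / 4) / √2 ≤ 3 / √π := by
    rw [div_le_div_iff₀ (by positivity) (by positivity)]
    refine abs_le_of_sq_le_sq' ?_ (by positivity) |>.2
    rw [mul_pow, mul_pow, sq_sqrt pi_pos.le, sq_sqrt (by norm_num), ← exp_nat_mul]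
    have h5 : exp ((2 : ℕ) * (3 / 4)) ≤ 4.5 := by
      refine abs_le_of_sq_le_sq' ?_ (by positivity) |>.2
      rw [← exp_nat_mul, show ((2 : ℕ) : ℝ) * ((2 : ℕ) * (3 / 4)) = (3 : ℕ) * 1 by norm_num,
        exp_nat_mul]
      have := exp_one_lt_d9
      calc exp 1 ^ 3 ≤ 2.7182818286 ^ 3 := by gcongr
        _ ≤ _ := by norm_num
    have h6 := pi_lt_d2
    exact (mul_le_mul h5 h6.le pi_pos.le (by norm_num)).trans (by norm_num)
  calc _ ≤ exp (-(lam / 2) + 2 * √(lam * n) + 3 / 4) / (2 * √(2 * √(lam * n))) * exp lam := by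
        gcongr
    _ = exp (lam / 2) * (exp (3 / 4) / √2) / (2 * lam ^ (1 / 4 : ℝ)) * ((n : ℝ) ^ (1 / 4 : ℝ))⁻¹ *
        exp (2 * √(lam * n)) := by
        rw [hss, show exp lam = exp (lam / 2) * exp (lam / 2) by rw [← exp_add]; congr 1; ring,
          exp_add, exp_add, exp_neg]
        field_simp
    _ ≤ exp (lam / 2) * (3 / √π) / (2 * lam ^ (1 / 4 : ℝ)) * ((n : ℝ) ^ (1 / 4 : ℝ))⁻¹ *
        exp (2 * √(lam * n)) := by gcongr
    _ = exp (lam / 2) * 3 / (2 * √π * lam ^ (1 / 4 : ℝ)) * (n : ℝ) ^ (-(1 / 4) : ℝ) *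
        exp (2 * √(lam * n)) := by
        rw [rpow_neg hn0.le]
        field_simp
    _ ≤ _ := by gcongr

end BesselLaguerre

/-! ### Monomial coefficients of Chebyshev polynomials -/

section ChebyshevCoefficients

open Polynomial Finset Polynomial.Chebyshev
open scoped Nat

theorem coeff_T_natCast_self (m : ℕ) : (T ℝ m).coeff m = 2 ^ (m - 1) := by
  have := leadingCoeff_T ℝ (m : ℤ)
  simpa [leadingCoeff, natDegree_T] using this

theorem coeff_T_natCast_eq_zero {m k : ℕ} (h : m < k) : (T ℝ m).coeff k = 0 :=
  coeff_eq_zero_of_natDegree_lt (by simpa [natDegree_T] using h)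

theorem coeff_T_add_two_succ (m k : ℕ) : (T ℝ (m + 2 : ℕ)).coeff (k + 1) =
    2 * (T ℝ (m + 1 : ℕ)).coeff k - (T ℝ m).coeff (k + 1) := by
  have h := T_add_two ℝ (m : ℤ)
  push_cast
  rw [h, mul_assoc, coeff_sub, ← C_ofNat, coeff_C_mul, coeff_X_mul]

theorem coeff_T_add_two_zero (m : ℕ) : (T ℝ (m + 2 : ℕ)).coeff 0 = -(T ℝ m).coeff 0 := by
  have h := T_add_two ℝ (m : ℤ)
  push_cast
  rw [h, mul_assoc, coeff_sub, ← C_ofNat, coeff_C_mul, mul_coeff_zero, coeff_X_zero]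
  simp

theorem coeff_T_natCast_eq_zero_of_odd (m k : ℕ) (h : Odd (m + k)) : (T ℝ m).coeff k = 0 := by
  induction m using Nat.twoStepInduction generalizing k with
  | zero =>
    have : k ≠ 0 := by rintro rfl; simp at h
    exact coeff_T_natCast_eq_zero (Nat.pos_of_ne_zero this)
  | one =>
    have : k ≠ 1 := by rintro rfl; simp [Nat.odd_iff] at h
    simp [coeff_X, this.symm]
  | more m ih1 ih2 =>
    have h' : Odd (m + k) := by rw [Nat.odd_iff] at h ⊢; omega
    cases k with
    | zero => rw [coeff_T_add_two_zero, ih1 _ h', neg_zero]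
    | succ k =>
      rw [coeff_T_add_two_succ, ih1 _ h', ih2 _ (by rw [Nat.odd_iff] at h ⊢; omega)]
      simp

/-- The right side is the classical closed form, which satisfies the three-term recurrence with both
terms added, so the triangle inequality carries the induction. Only `T 0` is excluded. -/
theorem abs_coeff_T_le (j k : ℕ) (h : k + j ≠ 0) : 2 * |(T ℝ (k + 2 * j : ℕ)).coeff k| ≤
    2 ^ k * ((k + 2 * j : ℕ) * ((k + j - 1)! : ℝ) / ((j ! : ℝ) * (k ! : ℝ))) := by
  induction j generalizing k with
  | zero =>
    obtain ⟨k, rfl⟩ := Nat.exists_eq_succ_of_ne_zero (show k ≠ 0 by omega)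
    rw [mul_zero, add_zero, coeff_T_natCast_self, Nat.factorial_succ]
    simp only [Nat.succ_eq_add_one, Nat.add_sub_cancel]
    have : ((k + 1 : ℕ) : ℝ) * (k ! : ℝ) / (((0 : ℕ)! : ℝ) * (((k + 1) * k ! : ℕ) : ℝ)) = 1 := by
      push_cast
      rw [Nat.factorial_zero, Nat.cast_one, one_mul]
      exact div_self (by positivity)
    rw [this, abs_of_pos (by positivity), pow_succ]
    linarith
  | succ j ih =>
    induction k with
    | zero =>
      have h0 : ∀ j : ℕ, |(T ℝ (2 * j : ℕ)).coeff 0| = 1 := fun j => by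
        induction j with
        | zero => simp
        | succ j ih => rw [mul_add, mul_one, coeff_T_add_two_zero, abs_neg, ih]
      rw [zero_add, h0, zero_add, Nat.add_sub_cancel, Nat.factorial_succ]
      push_cast
      have : (2 * ((j : ℝ) + 1) * (j ! : ℝ) / (((j : ℝ) + 1) * (j ! : ℝ) * (Nat.factorial 0 : ℝ))) = 2 := by
        rw [Nat.factorial_zero]
        field_simp
        simp
      rw [this]
      norm_num
    | succ k ihk =>
      have h1 := ihk (by omega)
      have h2 := ih (k + 1) (by omega)
      have e : k + 1 + 2 * (j + 1) = (k + 1 + 2 * j) + 2 := by ring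
      have e' : k + 2 * (j + 1) = (k + 1 + 2 * j) + 1 := by ring
      rw [e, coeff_T_add_two_succ]
      rw [e'] at h1
      calc 2 * |2 * (T ℝ (k + 1 + 2 * j + 1 : ℕ)).coeff k - (T ℝ (k + 1 + 2 * j : ℕ)).coeff (k + 1)|
          ≤ 2 * (2 * |(T ℝ (k + 1 + 2 * j + 1 : ℕ)).coeff k| +
              |(T ℝ (k + 1 + 2 * j : ℕ)).coeff (k + 1)|) := by
            gcongr
            refine (abs_sub _ _).trans ?_
            rw [abs_mul, abs_two]
        _ = 2 * (2 * |(T ℝ (k + 1 + 2 * j + 1 : ℕ)).coeff k|) +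
              2 * |(T ℝ (k + 1 + 2 * j : ℕ)).coeff (k + 1)| := by ring
        _ ≤ _ := add_le_add (mul_le_mul_of_nonneg_left h1 zero_le_two) h2
        _ = _ := by
          rw [show k + 1 + (j + 1) - 1 = k + j + 1 by omega, show k + (j + 1) - 1 = k + j by omega,
            show k + 1 + j - 1 = k + j by omega, Nat.factorial_succ (k + j), Nat.factorial_succ k,
            Nat.factorial_succ j]
          push_cast
          field_simp
          ring

/-- Log-convexity of the factorial. -/
theorem factorial_sq_le (a d : ℕ) : (a + d)! ^ 2 ≤ (a + 2 * d)! * a ! := by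
  induction d generalizing a with
  | zero => simp [sq]
  | succ d ih =>
    have h := ih (a + 1)
    rw [show a + 1 + d = a + (d + 1) by ring, show a + 1 + 2 * d = a + 2 * d + 1 by ring,
      Nat.factorial_succ a] at h
    refine h.trans ?_
    rw [show a + 2 * (d + 1) = a + 2 * d + 1 + 1 by ring, Nat.factorial_succ (a + 2 * d + 1)]
    calc (a + 2 * d + 1)! * ((a + 1) * a !) = (a + 1) * (a + 2 * d + 1)! * a ! := by ring
      _ ≤ _ := by gcongr; omega

/-- After squaring the closed form, log-convexity gives `(k + j - 1)!² ≤ (k + 2j - 2)! k!`, which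
cancels every factorial except `j!²`. -/
theorem coeff_T_sq_mul_factorial_le (j k : ℕ) (hj : j ≠ 0) :
    4 * (T ℝ (k + 2 * j : ℕ)).coeff k ^ 2 * ((k ! : ℝ) / ((k + 2 * j)! : ℝ)) ≤
      4 ^ k * (((k + 2 * j : ℕ) : ℝ) / ((k + 2 * j : ℕ) - 1)) / (j ! : ℝ) ^ 2 := by
  obtain ⟨i, rfl⟩ := Nat.exists_eq_succ_of_ne_zero hj
  have h := abs_coeff_T_le (i + 1) k (by omega)
  have h2 := pow_le_pow_left₀ (by positivity) h 2
  rw [mul_pow, sq_abs, mul_pow, ← pow_mul, mul_comm k, pow_mul] at h2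
  rw [show (2 : ℝ) ^ 2 = 4 by norm_num, show k + (i + 1) - 1 = k + i by omega] at h2
  have hf : ((k + i)! : ℝ) ^ 2 ≤ ((k + 2 * i)! : ℝ) * (k ! : ℝ) := by
    exact_mod_cast factorial_sq_le k i
  have hfac : ((k + 2 * (i + 1))! : ℝ) = (k + 2 * i + 2) * (k + 2 * i + 1) * ((k + 2 * i)! : ℝ) := by
    rw [show k + 2 * (i + 1) = k + 2 * i + 1 + 1 by ring, Nat.factorial_succ, Nat.factorial_succ]
    push_cast
    ring
  calc _ ≤ (4 ^ k * (((k + 2 * (i + 1) : ℕ) : ℝ) * ((k + i)! : ℝ) /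
        (((i + 1)! : ℝ) * (k ! : ℝ))) ^ 2) * ((k ! : ℝ) / ((k + 2 * (i + 1))! : ℝ)) := by
        exact mul_le_mul_of_nonneg_right h2 (by positivity)
    _ = 4 ^ k * (k + 2 * i + 2) / ((i + 1)! : ℝ) ^ 2 * (((k + i)! : ℝ) ^ 2 /
        ((k ! : ℝ) * ((k + 2 * i + 1) * ((k + 2 * i)! : ℝ)))) := by
        rw [hfac]
        push_cast
        field_simp
        ring
    _ ≤ 4 ^ k * (k + 2 * i + 2) / ((i + 1)! : ℝ) ^ 2 * ((((k + 2 * i)! : ℝ) * (k ! : ℝ)) /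
        ((k ! : ℝ) * ((k + 2 * i + 1) * ((k + 2 * i)! : ℝ)))) := by gcongr
    _ = _ := by
        have : (((k + 2 * (i + 1) : ℕ) : ℝ) - 1) = k + 2 * i + 1 := by push_cast; ring
        rw [Nat.succ_eq_add_one, this]
        push_cast
        field_simp
        ring

/-- A bound for the weighted sum of squares of the coefficients of a Chebyshev polynomial. -/
theorem sum_coeff_T_sq_le {lam : ℝ} (hlam : 0 < lam) {m : ℕ} (hm : m ≠ 0) :
    ∑ k ∈ range (m + 1), 4 * (T ℝ m).coeff k ^ 2 * (lam ^ (m - k) * ((k ! : ℝ) / (m ! : ℝ))) ≤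
      4 ^ m * (1 + (m : ℝ) / (m - 1) * (Real.exp (lam ^ 2 / 16) - 1)) := by
  -- `B i` bounds the term of degree `m - 2i`; the leading term `i = 0` is exact. For `m = 1` the
  -- quotient is `1 / 0 = 0`, harmlessly, as `T 1` has no lower terms.
  set B : ℕ → ℝ := fun i => 4 ^ m * ((if i = 0 then 1 else (m : ℝ) / (m - 1)) *
    ((lam ^ 2 / 16) ^ i / (i ! : ℝ))) with hB
  have hm1 : (1 : ℝ) ≤ m := by exact_mod_cast Nat.one_le_iff_ne_zero.2 hm
  have hmm : 0 ≤ (m : ℝ) / (m - 1) := div_nonneg (by positivity) (by linarith)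
  have hB0 : ∀ i, 0 ≤ B i := fun i => by
    rw [hB]
    dsimp only
    split_ifs <;> positivity
  have hle : ∀ d ∈ range (m + 1), 4 * (T ℝ m).coeff (m - d) ^ 2 *
      (lam ^ (m - (m - d)) * (((m - d)! : ℝ) / (m ! : ℝ))) ≤ if Even d then B (d / 2) else 0 := by
    intro d hd
    obtain ⟨k, rfl⟩ := Nat.exists_eq_add_of_le' (Nat.lt_succ_iff.1 (mem_range.1 hd))
    rw [Nat.add_sub_cancel, Nat.add_sub_cancel_left]
    split_ifs with hev
    · obtain ⟨i, rfl⟩ := even_iff_exists_two_mul.1 hev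
      rw [Nat.mul_div_cancel_left _ two_pos]
      by_cases hi : i = 0
      · subst hi
        obtain ⟨k, rfl⟩ := Nat.exists_eq_succ_of_ne_zero (show k ≠ 0 by omega)
        rw [mul_zero, add_zero, coeff_T_natCast_self, div_self (by positivity), hB]
        simp only [Nat.succ_eq_add_one, Nat.add_sub_cancel]
        rw [← pow_mul, mul_comm k, pow_mul]
        norm_num [pow_succ]
        linarith
      · have := coeff_T_sq_mul_factorial_le i k hi
        have h4 : (4 : ℝ) ^ (k + 2 * i) * (lam ^ 2 / 16) ^ i = 4 ^ k * lam ^ (2 * i) := by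
          rw [div_pow, pow_add, pow_mul, pow_mul]
          norm_num
          field_simp
        have hfi : (1 : ℝ) ≤ (i ! : ℝ) := by exact_mod_cast i.factorial_pos
        calc 4 * (T ℝ (k + 2 * i : ℕ)).coeff k ^ 2 *
              (lam ^ (2 * i) * ((k ! : ℝ) / ((k + 2 * i)! : ℝ)))
            = 4 * (T ℝ (k + 2 * i : ℕ)).coeff k ^ 2 * ((k ! : ℝ) / ((k + 2 * i)! : ℝ)) *
                lam ^ (2 * i) := by ring
          _ ≤ 4 ^ k * (((k + 2 * i : ℕ) : ℝ) / ((k + 2 * i : ℕ) - 1)) / (i ! : ℝ) ^ 2 *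
                lam ^ (2 * i) := by gcongr
          -- Weakening `1 / i!²` to `1 / i!` makes the sum an exponential series.
          _ ≤ 4 ^ k * (((k + 2 * i : ℕ) : ℝ) / ((k + 2 * i : ℕ) - 1)) / (i ! : ℝ) *
                lam ^ (2 * i) := by
              gcongr
              exact le_self_pow₀ hfi two_ne_zero
          _ = 4 ^ k * lam ^ (2 * i) * (((k + 2 * i : ℕ) : ℝ) / ((k + 2 * i : ℕ) - 1)) /
                (i ! : ℝ) := by ring
          _ = B i := by
              rw [← h4, hB]
              dsimp only
              rw [if_neg hi]
              ring
    · rw [coeff_T_natCast_eq_zero_of_odd]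
      · simp
      · rw [Nat.not_even_iff_odd, Nat.odd_iff] at hev
        rw [Nat.odd_iff]
        omega
  calc ∑ k ∈ range (m + 1), 4 * (T ℝ m).coeff k ^ 2 * (lam ^ (m - k) * ((k ! : ℝ) / (m ! : ℝ)))
      = ∑ d ∈ range (m + 1), 4 * (T ℝ m).coeff (m - d) ^ 2 *
          (lam ^ (m - (m - d)) * (((m - d)! : ℝ) / (m ! : ℝ))) :=
        (sum_range_reflect (fun k => 4 * (T ℝ m).coeff k ^ 2 *
          (lam ^ (m - k) * ((k ! : ℝ) / (m ! : ℝ)))) (m + 1)).symm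
    _ ≤ ∑ d ∈ range (m + 1), if Even d then B (d / 2) else 0 := sum_le_sum hle
    _ ≤ ∑ d ∈ range (2 * (m + 1)), if Even d then B (d / 2) else 0 := by
        refine sum_le_sum_of_subset_of_nonneg (range_subset_range.2 (by omega)) fun d _ _ => ?_
        split_ifs
        exacts [hB0 _, le_rfl]
    _ = ∑ i ∈ range (m + 1), B i := by
        rw [sum_range_two_mul_eq]
        refine sum_congr rfl fun i _ => ?_
        simp
    _ = 4 ^ m * (1 + (m : ℝ) / (m - 1) *
          (∑ i ∈ range (m + 1), (lam ^ 2 / 16) ^ i / (i ! : ℝ) - 1)) := by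
        rw [hB, ← mul_sum, sum_range_succ', sum_range_succ' (fun i => (lam ^ 2 / 16) ^ i / (i ! : ℝ))]
        simp only [Nat.add_eq_zero_iff, one_ne_zero, and_false, if_false, if_true, pow_zero,
          Nat.factorial_zero, Nat.cast_one, div_one, mul_one]
        rw [← mul_sum]
        ring
    _ ≤ _ := by
        gcongr
        exact Real.sum_le_exp_of_nonneg (by positivity) _

end ChebyshevCoefficients

/-! ### Chebyshev expansions and the maximum of a polynomial -/

section ChebyshevExpansion

open Polynomial Polynomial.Chebyshev Finset

theorem exists_eq_sum_smul_T {p : ℝ[X]} {n : ℕ} (hp : p.natDegree ≤ n) :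
    ∃ c : ℕ → ℝ, p = ∑ m ∈ range (n + 1), c m • T ℝ m := by
  have h : p ∈ Submodule.span ℝ ((chebyshevTsequence ℝ : ℕ → ℝ[X]) '' Set.Iic n) := by
    rw [Polynomial.Sequence.span_degreeLE, mem_degreeLE]
    · exact degree_le_of_natDegree_le hp
    · intro i _
      exact isUnit_iff_ne_zero.2 (leadingCoeff_ne_zero.2 (Sequence.ne_zero _ i))
  rw [show Set.Iic n = (range (n + 1) : Finset ℕ) by ext; simp,
    Submodule.mem_span_image_finset_iff_exists_fun'] at h
  obtain ⟨c, hc⟩ := h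
  exact ⟨c, hc.symm⟩

theorem integral_sum_smul_T_sq (c : ℕ → ℝ) (n : ℕ) :
    ∫ x, (∑ m ∈ range n, c m • T ℝ m).eval x ^ 2 ∂measureT =
      ∑ m ∈ range n, c m ^ 2 * (if m = 0 then Real.pi else Real.pi / 2) := by
  have h : ∀ x : ℝ, (∑ m ∈ range n, c m • T ℝ m).eval x ^ 2 =
      ∑ i ∈ range n, ∑ j ∈ range n, c i * c j * ((T ℝ i).eval x * (T ℝ j).eval x) := by
    intro x
    simp_rw [sq, eval_finsetSum, sum_mul_sum, eval_smul, smul_eq_mul]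
    exact sum_congr rfl fun i _ => sum_congr rfl fun j _ => by ring
  have hint : ∀ i j : ℕ, Integrable (fun x => c i * c j * ((T ℝ i).eval x * (T ℝ j).eval x))
      measureT := fun i j => integrable_measureT (by fun_prop)
  simp_rw [h]
  rw [integral_finsetSum _ fun i _ => integrable_finsetSum _ fun j _ => hint i j]
  refine sum_congr rfl fun i hi => ?_
  rw [integral_finsetSum _ fun j _ => hint i j, sum_eq_single i]
  · rw [integral_const_mul, sq]
    congr 1
    split_ifs with h0
    · subst h0
      exact integral_eval_T_real_mul_self_measureT_zero
    · exact integral_T_real_mul_self_measureT_of_ne_zero h0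
  · intro j _ hj
    rw [integral_const_mul, integral_eval_T_real_mul_eval_T_real_measureT_of_ne hj.symm, mul_zero]
  · exact fun h => absurd hi h

/-- A polynomial is somewhere on `[-1, 1]` at least as large as the `ℓ²` norm of its Chebyshev
coefficients, up to the factor `√2`. -/
theorem exists_sum_sq_le_two_mul_eval_sq (c : ℕ → ℝ) (n : ℕ) :
    ∃ t : SymmInterval, ∑ m ∈ range n, c m ^ 2 ≤
      2 * (∑ m ∈ range n, c m • T ℝ m).eval (t : ℝ) ^ 2 := by
  by_contra! hcon
  set p := ∑ m ∈ range n, c m • T ℝ m with hp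
  obtain ⟨t, ht, htmax⟩ := (isCompact_Icc (a := (-1 : ℝ)) (b := 1)).exists_isMaxOn (by simp)
    (f := fun x => p.eval x ^ 2) (by fun_prop)
  have h1 : ∫ x, p.eval x ^ 2 ∂measureT ≤ Real.pi * p.eval t ^ 2 := by
    rw [integral_measureT_eq_integral_cos (f := fun x => p.eval x ^ 2)]
    calc ∫ θ in (0 : ℝ)..Real.pi, p.eval (Real.cos θ) ^ 2
        ≤ ∫ _θ in (0 : ℝ)..Real.pi, p.eval t ^ 2 := by
          refine intervalIntegral.integral_mono_on Real.pi_pos.le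
            (Continuous.intervalIntegrable (by fun_prop) _ _) (by simp) fun θ _ => ?_
          exact htmax (Real.cos_mem_Icc θ)
      _ = _ := by simp
  -- Each `T m` has squared norm at least `π / 2`, against total mass `π`: this is the factor `2`.
  have h2 : Real.pi / 2 * ∑ m ∈ range n, c m ^ 2 ≤ ∫ x, p.eval x ^ 2 ∂measureT := by
    rw [hp, integral_sum_smul_T_sq, mul_sum]
    refine sum_le_sum fun m _ => ?_
    rw [mul_comm]
    gcongr
    split_ifs <;> linarith [Real.pi_pos]
  have h3 := hcon ⟨t, ht⟩
  have h4 : Real.pi * p.eval t ^ 2 < Real.pi / 2 * ∑ m ∈ range n, c m ^ 2 := by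
    have := mul_lt_mul_of_pos_left h3 (half_pos Real.pi_pos)
    linarith
  linarith

end ChebyshevExpansion

/-! ### Weighted coefficient sums under the growth condition on `α` -/

section WeightedCoefficients

open Polynomial Finset Polynomial.Chebyshev Real
open scoped Nat

/-- A substitute for Stirling's formula, resting on `(1 + 1/a)ʳ ≤ e` for `r ≤ a`. It makes the lower
Chebyshev degrees decay geometrically. -/
theorem add_pow_mul_factorial_le (m r : ℕ) :
    ((m + r : ℕ) : ℝ) ^ r * (m ! : ℝ) ≤ exp 1 ^ r * ((m + r)! : ℝ) := by
  induction r with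
  | zero => simp
  | succ r ih =>
    have h : ((m + r : ℕ) + 1 : ℝ) ^ r ≤ exp 1 * ((m + r : ℕ) : ℝ) ^ r := by
      rcases Nat.eq_zero_or_pos (m + r) with h0 | h0
      · obtain rfl : r = 0 := by omega
        simp
      · have ha : (0 : ℝ) < (m + r : ℕ) := by exact_mod_cast h0
        have h1 : ((m + r : ℕ) : ℝ) + 1 ≤ (m + r : ℕ) * exp (1 / (m + r : ℕ)) := by
          have := add_one_le_exp (1 / ((m + r : ℕ) : ℝ))
          calc ((m + r : ℕ) : ℝ) + 1 = (m + r : ℕ) * (1 / ((m + r : ℕ) : ℝ) + 1) := by field_simp; ring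
            _ ≤ _ := by gcongr
        calc ((m + r : ℕ) + 1 : ℝ) ^ r ≤ ((m + r : ℕ) * exp (1 / (m + r : ℕ))) ^ r := by gcongr
          _ = exp (r * (1 / (m + r : ℕ))) * ((m + r : ℕ) : ℝ) ^ r := by
            rw [mul_pow, ← exp_nat_mul, mul_comm]
          _ ≤ _ := by
            gcongr
            rw [mul_one_div, div_le_one ha]
            exact_mod_cast Nat.le_add_left r m
    rw [← add_assoc, Nat.factorial_succ, pow_succ, pow_succ]
    push_cast at h ih ⊢
    calc (m + r + 1 : ℝ) ^ r * (m + r + 1) * (m ! : ℝ)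
        ≤ (exp 1 * (m + r : ℝ) ^ r) * (m + r + 1) * (m ! : ℝ) := by gcongr
      _ = exp 1 * (m + r + 1) * ((m + r : ℝ) ^ r * (m ! : ℝ)) := by ring
      _ ≤ exp 1 * (m + r + 1) * (exp 1 ^ r * ((m + r)! : ℝ)) := by gcongr
      _ = _ := by ring

namespace WeightedPowerSeries

variable {D : WeightedPowerSeries} {lam : ℝ}

theorem AssumptionAlpha.α_le (hα : D.AssumptionAlpha lam) {n k : ℕ} (h : k ≤ n) :
    D.α k ≤ D.α n * (lam ^ (n - k) * ((k ! : ℝ) / (n ! : ℝ))) := by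
  have := hα.2 n k h
  rwa [div_le_iff₀' (D.α_pos n)] at this

theorem AssumptionAlpha.sum_coeff_T_sq_le (hα : D.AssumptionAlpha lam) {m : ℕ} (hm : m ≠ 0) :
    ∑ k ∈ range (m + 1), 4 * (D.α k * (T ℝ m).coeff k ^ 2) ≤
      D.α m * (4 ^ m * (1 + (m : ℝ) / (m - 1) * (exp (lam ^ 2 / 16) - 1))) := by
  have hαm := D.α_pos m
  refine le_trans ?_ (mul_le_mul_of_nonneg_left (_root_.sum_coeff_T_sq_le hα.1 hm) hαm.le)
  rw [mul_sum]
  refine sum_le_sum fun k hk => ?_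
  have := hα.α_le (Nat.lt_succ_iff.1 (mem_range.1 hk))
  calc 4 * (D.α k * (T ℝ m).coeff k ^ 2)
      ≤ 4 * (D.α m * (lam ^ (m - k) * ((k ! : ℝ) / (m ! : ℝ))) * (T ℝ m).coeff k ^ 2) := by gcongr
    _ = _ := by ring

/-- A cruder bound for the degrees below `n`; the factor `4` accommodates `m = 0`. -/
theorem AssumptionAlpha.sum_coeff_T_sq_le_four_mul (hα : D.AssumptionAlpha lam) (m : ℕ) :
    ∑ k ∈ range (m + 1), 4 * (D.α k * (T ℝ m).coeff k ^ 2) ≤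
      D.α m * (4 ^ m * (4 * exp (lam ^ 2 / 16))) := by
  have hαm := D.α_pos m
  have hexp : 1 ≤ exp (lam ^ 2 / 16) := one_le_exp (by positivity)
  rcases eq_or_ne m 0 with rfl | hm
  · simp
    nlinarith
  · refine (hα.sum_coeff_T_sq_le hm).trans ?_
    have hm2 : (m : ℝ) / (m - 1) ≤ 2 := by
      rcases eq_or_ne m 1 with rfl | hm1
      · simp
      · have : (2 : ℝ) ≤ m := by exact_mod_cast (by omega : 2 ≤ m)
        rw [div_le_iff₀ (by linarith)]
        linarith
    gcongr
    nlinarith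

/-- The weighted coefficients of all Chebyshev polynomials of degree at most `n`. -/
theorem AssumptionAlpha.sum_sum_coeff_T_sq_le (hα : D.AssumptionAlpha lam) {n : ℕ}
    (hn : mL lam ≤ n) :
    ∑ m ∈ range (n + 1), ∑ k ∈ range (n + 1), D.α k * (T ℝ m).coeff k ^ 2 ≤
      D.α n * 4 ^ n * (1 + lam) / 4 * exp (lam ^ 2 / 16) := by
  have hlam := hα.1
  have h5 : 5 * lam ≤ n := (le_max_left _ _).trans hn
  have h9 : 9 ≤ lam * n := by
    have : 9 / lam ≤ n := (le_max_right _ _).trans ((le_max_right _ _).trans hn)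
    rwa [div_le_iff₀' hlam] at this
  -- `n² ≥ 5 lam n ≥ 45`.
  have hn7 : (7 : ℝ) ≤ n := by
    have : 7 ≤ n := by
      by_contra! h
      have : (n : ℝ) ≤ 6 := by exact_mod_cast (by omega : n ≤ 6)
      nlinarith
    exact_mod_cast this
  have hαn := D.α_pos n
  set E := exp (lam ^ 2 / 16) with hE
  have hE0 : 0 < E := exp_pos _
  have hinner : ∀ m ∈ range (n + 1), ∑ k ∈ range (n + 1), D.α k * (T ℝ m).coeff k ^ 2 =
      (∑ k ∈ range (m + 1), 4 * (D.α k * (T ℝ m).coeff k ^ 2)) / 4 := by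
    intro m hm
    rw [← mul_sum, mul_div_cancel_left₀ _ four_ne_zero]
    refine (sum_subset (range_subset_range.2 (by simpa using hm)) fun k _ hk => ?_).symm
    rw [coeff_T_natCast_eq_zero (by simpa using hk)]
    simp
  rw [sum_congr rfl hinner, ← sum_div, div_le_iff₀ four_pos, sum_range_succ]
  have htop : ∑ k ∈ range (n + 1), 4 * (D.α k * (T ℝ n).coeff k ^ 2) ≤
      D.α n * 4 ^ n * (1 + lam / 10) * E := by
    refine (hα.sum_coeff_T_sq_le (by rintro rfl; simp at hn7; linarith)).trans ?_
    rw [← hE, ← mul_assoc, mul_assoc _ (1 + lam / 10)]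
    gcongr
    have h1 : E - 1 ≤ lam ^ 2 / 16 * E := by
      have := add_one_le_exp (-(lam ^ 2 / 16))
      rw [exp_neg, ← hE] at this
      have h2 := mul_le_mul_of_nonneg_right this hE0.le
      rw [inv_mul_cancel₀ hE0.ne'] at h2
      linarith
    have hn1 : (0 : ℝ) < n - 1 := by linarith
    have h2 : (n : ℝ) / (n - 1) = 1 + 1 / (n - 1) := by field_simp; ring
    have h3 : 1 / ((n : ℝ) - 1) * (E - 1) ≤ lam / 10 * E := by
      rw [one_div_mul_eq_div, div_le_iff₀ hn1]
      refine h1.trans ?_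
      have : lam ^ 2 / 16 ≤ lam / 10 * (n - 1) := by nlinarith
      calc lam ^ 2 / 16 * E ≤ (lam / 10 * (n - 1)) * E := by gcongr
        _ = _ := by ring
    rw [h2, one_add_mul]
    linarith
  -- The ratio of the geometric decay in `n - m`: the factor `lam e / n` from `α` and the
  -- factorials, with `e ≤ 28/10`, divided by `4` from `4ᵐ` against `4ⁿ`.
  set z := 7 / 10 * lam / n with hz
  have hn0 : (0 : ℝ) < n := by linarith
  have hz0 : 0 ≤ z := by positivity
  have hz1 : z ≤ 7 / 50 := by
    rw [hz, div_le_iff₀ hn0]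
    linarith
  have hz2 : z ≤ lam / 10 := by
    rw [hz, div_le_iff₀ hn0]
    nlinarith
  have hlow : ∀ m ∈ range n, ∑ k ∈ range (m + 1), 4 * (D.α k * (T ℝ m).coeff k ^ 2) ≤
      D.α n * 4 ^ n * (4 * E) * z ^ (n - m) := by
    intro m hm
    obtain ⟨r, rfl⟩ := Nat.exists_eq_add_of_le (mem_range.1 hm).le
    refine (hα.sum_coeff_T_sq_le_four_mul m).trans ?_
    rw [← hE]
    have hα' := hα.α_le (Nat.le_add_right m r)
    rw [Nat.add_sub_cancel_left] at hα' ⊢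
    have hfac := add_pow_mul_factorial_le m r
    have hfac' : (m ! : ℝ) / ((m + r)! : ℝ) ≤ (exp 1 / (m + r : ℕ)) ^ r := by
      rw [div_pow, div_le_div_iff₀ (by positivity) (by positivity)]
      linarith
    have he : exp 1 ≤ 28 / 10 := by linarith [exp_one_lt_d9]
    calc D.α m * (4 ^ m * (4 * E))
        ≤ (D.α (m + r) * (lam ^ r * (exp 1 / (m + r : ℕ)) ^ r)) *
            (4 ^ m * (4 * E)) := by
          gcongr
          exact hα'.trans (by gcongr)
      _ ≤ (D.α (m + r) * (lam ^ r * ((28 / 10) / (m + r : ℕ)) ^ r)) *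
            (4 ^ m * (4 * E)) := by gcongr
      _ = _ := by
          rw [pow_add 4 m, hz, show (7 : ℝ) / 10 * lam / (m + r : ℕ) =
            (lam * (28 / 10 / (m + r : ℕ))) / 4 by ring, div_pow _ (4 : ℝ), mul_pow lam]
          field_simp
  have hgeom : ∑ m ∈ range n, z ^ (n - m) ≤ lam * (6 / 50) := by
    rw [← sum_range_reflect]
    have h1 : ∀ j ∈ range n, z ^ (n - (n - 1 - j)) = z * z ^ j := fun j hj => by
      rw [← pow_succ']
      congr 1
      have := mem_range.1 hj
      omega
    rw [sum_congr rfl h1, ← mul_sum]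
    have h2 : (∑ j ∈ range n, z ^ j) * (1 - z) ≤ 1 := by
      rw [geom_sum_mul_neg]
      linarith [pow_nonneg hz0 n]
    have h3 : ∑ j ∈ range n, z ^ j ≤ 6 / 5 := by
      have : 0 ≤ ∑ j ∈ range n, z ^ j := sum_nonneg fun j _ => by positivity
      nlinarith
    calc z * ∑ j ∈ range n, z ^ j ≤ lam / 10 * (6 / 5) := by gcongr
      _ = _ := by ring
  have hlow' := (sum_le_sum hlow).trans_eq (mul_sum _ _ _).symm
  calc _ ≤ D.α n * 4 ^ n * (4 * E) * (lam * (6 / 50)) + D.α n * 4 ^ n * (1 + lam / 10) * E :=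
        add_le_add (hlow'.trans (by gcongr)) htop
    -- `4 · 6/50` from the lower degrees plus `1/10` from degree `n`.
    _ = D.α n * 4 ^ n * E * (1 + lam * (29 / 50)) := by ring
    _ ≤ D.α n * 4 ^ n * E * (1 + lam) := by
        gcongr
        linarith
    _ = _ := by ring

/-- The weighted coefficients of a polynomial of degree at most `n` are controlled by its
maximum on `[-1, 1]`. -/
theorem AssumptionAlpha.exists_sum_coeff_sq_le (hα : D.AssumptionAlpha lam) {n : ℕ}
    (hn : mL lam ≤ n) {p : ℝ[X]} (hp : p.natDegree ≤ n) :
    ∃ t : SymmInterval, ∑ k ∈ range (n + 1), D.α k * p.coeff k ^ 2 ≤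
      D.α n * 4 ^ n * (1 + lam) / 2 * exp (lam ^ 2 / 16) * p.eval (t : ℝ) ^ 2 := by
  obtain ⟨c, hc⟩ := exists_eq_sum_smul_T hp
  obtain ⟨t, ht⟩ := exists_sum_sq_le_two_mul_eval_sq c (n + 1)
  rw [← hc] at ht
  refine ⟨t, ?_⟩
  have hlam := hα.1
  have hαn := D.α_pos n
  calc ∑ k ∈ range (n + 1), D.α k * p.coeff k ^ 2
      ≤ ∑ k ∈ range (n + 1), D.α k * ((∑ m ∈ range (n + 1), c m ^ 2) *
          ∑ m ∈ range (n + 1), (T ℝ m).coeff k ^ 2) := by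
        refine sum_le_sum fun k _ => mul_le_mul_of_nonneg_left ?_ (D.α_pos k).le
        rw [hc, finsetSum_coeff]
        simp_rw [coeff_smul, smul_eq_mul]
        exact sum_mul_sq_le_sq_mul_sq _ _ _
    _ = (∑ m ∈ range (n + 1), c m ^ 2) *
          ∑ m ∈ range (n + 1), ∑ k ∈ range (n + 1), D.α k * (T ℝ m).coeff k ^ 2 := by
        rw [sum_comm (s := range (n + 1)), mul_sum]
        refine sum_congr rfl fun k _ => ?_
        rw [← mul_sum]
        ring
    _ ≤ (2 * p.eval (t : ℝ) ^ 2) * (D.α n * 4 ^ n * (1 + lam) / 4 * exp (lam ^ 2 / 16)) :=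
        mul_le_mul ht (hα.sum_sum_coeff_T_sq_le hn)
          (sum_nonneg fun m _ => sum_nonneg fun k _ => mul_nonneg (D.α_pos k).le (sq_nonneg _))
          (by positivity)
    _ = _ := by ring

end WeightedPowerSeries

end WeightedCoefficients

/-! ### Two-sided bounds for the weighted interpolant -/

section WeightedInterpolation

open Polynomial Finset Real
open scoped Nat

variable (D : WeightedPowerSeries) {n : ℕ} (x : Fin n → SymmInterval)

/-- The weighted polynomial interpolant as a linear approximation. -/
noncomputable def weightedLagrange : LinearApproximation x where
  ψ k t := D.φ t / D.φ (x k) * (Lagrange.basis univ (fun i => (x i : ℝ)) k).eval (t : ℝ)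
  measurable k := by
    have h1 : AEMeasurable D.φ volume := D.φ_measurable.aemeasurable
    have h2 : Continuous fun t : SymmInterval =>
      (Lagrange.basis univ (fun i => (x i : ℝ)) k).eval (t : ℝ) := by fun_prop
    exact ((h1.div_const _).mul h2.aemeasurable).nullMeasurable

theorem weightedLagrange_approx (f : SymmInterval → ℝ) (t : SymmInterval) :
    (weightedLagrange D x).approx f t = weightedInterpolant D x f t := by
  simp only [LinearApproximation.approx, weightedLagrange, weightedInterpolant, mul_sum,
    Lagrange.eval_basis_univ]
  exact sum_congr rfl fun k _ => by ring

/-- The error at `t` of interpolating the monomial of degree `k`. -/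
noncomputable def monomialError (k : ℕ) (t : ℝ) : ℝ :=
  t ^ k - ∑ j, (x j : ℝ) ^ k * (Lagrange.basis univ (fun i => (x i : ℝ)) j).eval t

theorem hasSum_norm_sq_representer_weightedLagrange (t : SymmInterval) :
    HasSum (fun m : ℕ => D.φ t ^ 2 * ((D.α m)⁻¹ * monomialError x m t ^ 2))
      (‖(weightedLagrange D x).representer D t‖ ^ 2) := by
  convert (weightedLagrange D x).hasSum_norm_sq_representer D t using 2 with m
  have : D.φ t * (t : ℝ) ^ m - ∑ k, (weightedLagrange D x).ψ k t * D.φ (x k) * (x k : ℝ) ^ m =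
      D.φ t * monomialError x m t := by
    rw [monomialError, mul_sub, mul_sum]
    congr 1
    refine sum_congr rfl fun k _ => ?_
    have := D.φ_ne_zero (x k)
    simp only [weightedLagrange]
    field_simp
  rw [this]
  ring

variable {D x} {lam : ℝ}

/-- The ratio `n! / (n + j)!` from the growth condition cancels one of the two binomials in the
squared error and leaves `1 / j!`. -/
theorem inv_α_mul_monomialError_sq_le (hα : D.AssumptionAlpha lam) (hx : Function.Injective x)
    (t : SymmInterval) (j : ℕ) :
    (D.α (j + n))⁻¹ * monomialError x (j + n) t ^ 2 ≤
      4 ^ n * (D.α n)⁻¹ * (((n + j).choose j : ℝ) * lam ^ j / (j ! : ℝ)) := by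
  have hE := abs_pow_sub_interpolant_le (v := fun i => (x i : ℝ))
    (Subtype.val_injective.comp hx) (fun i => abs_le.2 (x i).2) (j + n) (abs_le.2 t.2)
  have hE2 : monomialError x (j + n) t ^ 2 ≤ (2 ^ n * ((j + n).choose n : ℝ)) ^ 2 := by
    rw [← sq_abs]
    exact pow_le_pow_left₀ (abs_nonneg _) hE 2
  have hlam := hα.1
  have hαn := D.α_pos n
  have hαj := D.α_pos (j + n)
  have h1 := hα.α_le (Nat.le_add_left n j)
  rw [Nat.add_sub_cancel] at h1
  have h2 : (D.α (j + n))⁻¹ ≤ (D.α n)⁻¹ * (lam ^ j * ((n ! : ℝ) / ((j + n)! : ℝ))) := by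
    rw [inv_mul_eq_div, le_div_iff₀ hαn, inv_mul_le_iff₀ hαj]
    exact h1
  have hc : ((j + n)! : ℝ) = ((j + n).choose n : ℝ) * (j ! : ℝ) * (n ! : ℝ) := by
    rw [← Nat.add_choose_mul_factorial_mul_factorial j n]
    push_cast
    ring
  have hcpos : (0 : ℝ) < ((j + n).choose n : ℝ) := by
    exact_mod_cast Nat.choose_pos (Nat.le_add_left n j)
  have hsymm : (n + j).choose j = (j + n).choose n := by
    rw [add_comm, Nat.choose_symm_add]
  calc _ ≤ ((D.α n)⁻¹ * (lam ^ j * ((n ! : ℝ) / ((j + n)! : ℝ)))) *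
        (2 ^ n * ((j + n).choose n : ℝ)) ^ 2 := by gcongr
    _ = _ := by
        rw [hc, hsymm, mul_pow, ← pow_mul, mul_comm n, pow_mul]
        norm_num
        field_simp

theorem norm_representer_weightedLagrange_le (hφ : D.AssumptionPhi) (hα : D.AssumptionAlpha lam)
    (hn : mL lam ≤ n) (hx : Function.Injective x) (t : SymmInterval) :
    ‖(weightedLagrange D x).representer D t‖ ≤
      c2Inf D lam / 2 * (n : ℝ) ^ (-(1 / 8) : ℝ) * exp √(lam * n) * 2 ^ n *
        (D.α n) ^ (-(1 / 2) : ℝ) := by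
  have hlam := hα.1
  have hαn := D.α_pos n
  have hn0 : (0 : ℝ) < n :=
    lt_of_lt_of_le (by positivity) ((le_max_left (5 * lam) _).trans hn)
  have hφt : |D.φ t| ≤ D.φmax := le_ciSup hφ.2 t
  have hφmax : 0 ≤ D.φmax := (abs_nonneg _).trans hφt
  have hcL : 0 ≤ cL lam := by unfold cL; positivity
  have hsum := (hasSum_nat_add_iff' n).2 (hasSum_norm_sq_representer_weightedLagrange D x t)
  have hzero : ∑ m ∈ range n, D.φ t ^ 2 * ((D.α m)⁻¹ * monomialError x m t ^ 2) = 0 := by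
    refine sum_eq_zero fun m hm => ?_
    have : monomialError x m t = 0 := pow_sub_interpolant_eq_zero
      (Subtype.val_injective.comp hx) (mem_range.1 hm) _
    rw [this]
    simp
  rw [hzero, sub_zero] at hsum
  have hle := hasSum_le (fun j => mul_le_mul (sq_le_sq' (neg_le_of_abs_le hφt)
    (le_of_abs_le hφt)) (inv_α_mul_monomialError_sq_le hα hx t j)
    (mul_nonneg (inv_nonneg.2 (D.α_pos _).le) (sq_nonneg _)) (sq_nonneg _)) hsum
    (((hasSum_choose_mul_pow_div_factorial lam n).mul_left _).mul_left _)
  have hsqrt : (D.α n) ^ (-(1 / 2) : ℝ) = (√(D.α n))⁻¹ := by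
    rw [rpow_neg hαn.le, sqrt_eq_rpow]
  have hpow : ((n : ℝ) ^ (-(1 / 8) : ℝ)) ^ 2 = (n : ℝ) ^ (-(1 / 4) : ℝ) := by
    rw [← rpow_natCast, ← rpow_mul hn0.le]
    norm_num
  refine abs_le_of_sq_le_sq' ?_ (by unfold c2Inf; positivity) |>.2
  calc _ ≤ _ := hle
    _ ≤ D.φmax ^ 2 * (4 ^ n * (D.α n)⁻¹ *
        (cL lam * (n : ℝ) ^ (-(1 / 4) : ℝ) * exp (2 * √(lam * n)))) := by
        refine mul_le_mul_of_nonneg_left (mul_le_mul_of_nonneg_left ?_ (by positivity))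
          (sq_nonneg _)
        exact laguerre_bound_le_cL hlam hn
    _ = _ := by
        rw [c2Inf, hsqrt, ← hpow, two_mul √(lam * n), exp_add]
        simp only [mul_pow, inv_pow, div_pow]
        rw [sq_sqrt hαn.le, sq_sqrt hcL, ← pow_mul, mul_comm n, pow_mul]
        norm_num
        ring

theorem exists_le_norm_representer_weightedLagrange (hφ : D.AssumptionPhi)
    (hα : D.AssumptionAlpha lam) (hn : mL lam ≤ n) :
    ∃ t, c1Inf D lam * (2 : ℝ)⁻¹ ^ n * (D.α n) ^ (-(1 / 2) : ℝ) ≤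
      ‖(weightedLagrange D x).representer D t‖ := by
  have hlam := hα.1
  have hαn := D.α_pos n
  set w := Lagrange.nodal univ (fun i => (x i : ℝ)) with hw
  have hdeg : w.natDegree = n := by simp [hw, Lagrange.natDegree_nodal]
  obtain ⟨t, ht⟩ := hα.exists_sum_coeff_sq_le hn hdeg.le
  refine ⟨t, abs_le_of_sq_le_sq' ?_ (norm_nonneg _) |>.2⟩
  set S := ∑ k ∈ range (n + 1), D.α k * w.coeff k ^ 2 with hS
  set R := ∑ k ∈ range (n + 1), (D.α k)⁻¹ * monomialError x k t ^ 2 with hR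
  set M := D.α n * 4 ^ n * (1 + lam) / 2 * exp (lam ^ 2 / 16) with hM
  have hM0 : 0 < M := by positivity
  -- The nodal polynomial is monic, so `S ≥ α n`; positivity lets `S` be cancelled from `S ≤ M w(t)²
  -- ≤ M S R`.
  have hS0 : 0 < S := by
    refine lt_of_lt_of_le hαn ?_
    have h1 : D.α n * w.coeff n ^ 2 ≤ S := single_le_sum
      (f := fun k => D.α k * w.coeff k ^ 2)
      (fun k _ => mul_nonneg (D.α_pos k).le (sq_nonneg _)) (self_mem_range_succ n)
    have h2 : w.coeff n = 1 := by
      have := Lagrange.nodal_monic (s := univ) (v := fun i => (x i : ℝ))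
      rw [← hw, Monic, leadingCoeff, hdeg] at this
      exact this
    simpa [h2] using h1
  have hCS : w.eval (t : ℝ) ^ 2 ≤ S * R := by
    rw [hw, eval_nodal_eq_sum_coeff_mul, ← hw]
    refine sum_sq_le_sum_mul_sum_of_sq_le_mul _
      (fun k _ => mul_nonneg (D.α_pos k).le (sq_nonneg _))
      (fun k _ => mul_nonneg (inv_nonneg.2 (D.α_pos k).le) (sq_nonneg _)) fun k _ => le_of_eq ?_
    have := (D.α_pos k).ne'
    rw [monomialError]
    field_simp
  have hR1 : M⁻¹ ≤ R := by
    have hR0 : 0 ≤ R :=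
      sum_nonneg fun k _ => mul_nonneg (inv_nonneg.2 (D.α_pos k).le) (sq_nonneg _)
    rw [inv_le_iff_one_le_mul₀ hM0]
    have : S * 1 ≤ S * (R * M) := by
      calc S * 1 ≤ M * w.eval (t : ℝ) ^ 2 := by rw [mul_one]; exact ht
        _ ≤ M * (S * R) := by gcongr
        _ = _ := by ring
    exact le_of_mul_le_mul_left this hS0
  have hrep : D.φ t ^ 2 * R ≤ ‖(weightedLagrange D x).representer D t‖ ^ 2 := by
    rw [hR, mul_sum]
    exact sum_le_hasSum _ (fun k _ => mul_nonneg (sq_nonneg _)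
      (mul_nonneg (inv_nonneg.2 (D.α_pos k).le) (sq_nonneg _)))
      (hasSum_norm_sq_representer_weightedLagrange D x t)
  have hφt : D.φmin ^ 2 ≤ D.φ t ^ 2 := by
    rw [← sq_abs (D.φ t)]
    exact pow_le_pow_left₀ hφ.1.le
      (ciInf_le ⟨0, Set.forall_mem_range.2 fun _ => abs_nonneg _⟩ t) 2
  have hsqrt : (D.α n) ^ (-(1 / 2) : ℝ) = (√(D.α n))⁻¹ := by
    rw [rpow_neg hαn.le, sqrt_eq_rpow]
  calc (c1Inf D lam * (2 : ℝ)⁻¹ ^ n * (D.α n) ^ (-(1 / 2) : ℝ)) ^ 2 = D.φmin ^ 2 * M⁻¹ := by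
        rw [c1Inf, hsqrt, hM]
        simp only [mul_pow, inv_pow]
        rw [sq_sqrt hαn.le, sq_sqrt (by positivity), ← exp_nat_mul, ← pow_mul, mul_comm n, pow_mul,
          show ((2 : ℕ) : ℝ) * -(lam ^ 2 / 32) = -(lam ^ 2 / 16) by push_cast; ring, exp_neg]
        norm_num
        field_simp
    _ ≤ D.φ t ^ 2 * R := by gcongr
    _ ≤ _ := hrep

end WeightedInterpolation

theorem theorem3p5 (D : WeightedPowerSeries) (lam : ℝ)
    (hφ : D.AssumptionPhi) (hα : D.AssumptionAlpha lam)
    (n : ℕ) (hn : mL lam ≤ (n : ℝ))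
    (x : Fin n → SymmInterval) (hx : Function.Injective x) :
    ∃ A : LinearApproximation x,
      (∀ (f : SymmInterval → ℝ) (t : SymmInterval), A.approx f t = weightedInterpolant D x f t) ∧
      ENNReal.ofReal (c1Inf D lam * (2 : ℝ)⁻¹ ^ n * (D.α n) ^ (-(1 / 2) : ℝ))
        ≤ A.worstCaseError D ∧
      A.worstCaseError D ≤
        ENNReal.ofReal (c2Inf D lam / 2 * (n : ℝ) ^ (-(1 / 8) : ℝ) * Real.exp √(lam * n)
          * 2 ^ n * (D.α n) ^ (-(1 / 2) : ℝ)) := by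
  refine ⟨weightedLagrange D x, weightedLagrange_approx D x, ?_,
    LinearApproximation.worstCaseError_le _ D fun t =>
      norm_representer_weightedLagrange_le hφ hα hn hx t⟩
  obtain ⟨t, ht⟩ := exists_le_norm_representer_weightedLagrange (x := x) hφ hα hn
  exact (ENNReal.ofReal_le_ofReal ht).trans (LinearApproximation.le_worstCaseError _ D t)
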